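/- Let $n\ge 1$ and $k\ge 2$ be integers with $k\mid n$, and let $\mathcal J=\{J\subseteq\{1,\dots,n\}:|J|=k\}$. Let $\mathbb S^{(n,k)}$ be the space of families $\mathcal Y=(Y_J)_{J\in\mathcal J}$ of real symmetric $k\times k$ matrices, with inner product $\langle\mathcal X,\mathcal Y\rangle=\sum_{J}\operatorname{tr}(X_JY_J)$, and let $\mathbb S_+^{(n,k)}$ be the cone of those families in which every $Y_J$ is positive semidefinite. For $J=\{i_1<\dots<i_k\}$ let $Y_J^{\to n}$ be the $n\times n$ matrix whose $(i_a,i_b)$ entry is $(Y_J)_{a,b}$ and whose other entries are $0$, and put $\Psi(\mathcal Y)=\sum_{J\in\mathcal J}Y_J^{\to n}$. A functional $f$ on an open convex set $D$ of a finite-dimensional Euclidean space, twice continuously differentiable with gradient $g(x)$ and positive definite Hessian $H(x)$ at each $x\in D$, is called a *self-concordant barrier* on $D$ if, with $\|v\|_x:=\langle v,H(x)v\rangle^{1/2}$, (i) for every $x\in D$, every $y$ with $\|y-x\|_x<1$ lies in $D$ and satisfies $$1-\|y-x\|_x\le\frac{\|v\|_y}{\|v\|_x}\le\frac1{1-\|y-x\|_x}\quad\text{for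 all }v\neq0;$$ (ii) $\sup_{x\in D}\|H(x)^{-1}g(x)\|_x^2<\infty$. Then $$f^{\mathrm{FW}(k)}(\mathcal Y)=-\sum_{J\in\mathcal J}\log\det Y_J$$ is a self-concordant barrier on $\operatorname{int}\mathbb S_+^{(n,k)}$. Furthermore, if $\mathcal Y\in\operatorname{int}\mathbb S_+^{(n,k)}$ and $X=\Psi(\mathcal Y)$, then $$f^{\mathrm{FW}(k)}(\mathcal Y)\ \ge\ -\binom{n-1}{k-1}\log\det X+n\binom{n-1}{k-1}\log\binom{n-1}{k-1}.$$ -/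

import Mathlib

noncomputable section

namespace FactorWidth

section SelfConcordance

variable {E : Type*} [NormedAddCommGroup E] [InnerProductSpace ℝ E] [CompleteSpace E]

/-- The Hessian `H(x)` of `f` at `x` with respect to the reference inner product of `E`:
the derivative at `x` of the gradient of `f`, as a linear operator on `E`. -/
def hessian (f : E → ℝ) (x : E) : E →L[ℝ] E :=
  fderiv ℝ (gradient f) x

/-- The local inner product `⟨u, v⟩_x = ⟨u, H(x) v⟩`. -/
def localInner (f : E → ℝ) (x u v : E) : ℝ :=
  inner ℝ u (hessian f x v)

/-- The local norm `‖v‖_x = √⟨v, v⟩_x`. -/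
def localNorm (f : E → ℝ) (x v : E) : ℝ :=
  Real.sqrt (localInner f x v v)

/-- The open ball `B_x(y, r)` with centre `y` and radius `r` in the local norm at `x`. -/
def localBall (f : E → ℝ) (x y : E) (r : ℝ) : Set E :=
  {z | localNorm f x (z - y) < r}

/-- `f` with domain `D` is (strongly non-degenerate) self-concordant: `D` is open and convex,
`f` is twice continuously differentiable on `D` with positive definite Hessian, and for every
`x ∈ D` the unit ball `B_x(x, 1)` lies in `D` and the local norms at its points `y` satisfy
`1 - ‖y - x‖_x ≤ ‖v‖_y / ‖v‖_x ≤ 1 / (1 - ‖y - x‖_x)` for all `v ≠ 0`. -/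
structure IsSelfConcordant [FiniteDimensional ℝ E] (f : E → ℝ) (D : Set E) : Prop where
  isOpen : IsOpen D
  convex : Convex ℝ D
  contDiffOn : ContDiffOn ℝ 2 f D
  hessian_pos : ∀ x ∈ D, ∀ v : E, v ≠ 0 → 0 < localInner f x v v
  ball_subset : ∀ x ∈ D, localBall f x x 1 ⊆ D
  norm_ratio : ∀ x ∈ D, ∀ y ∈ localBall f x x 1, ∀ v : E, v ≠ 0 →
    1 - localNorm f x (y - x) ≤ localNorm f y v / localNorm f x v ∧
      localNorm f y v / localNorm f x v ≤ 1 / (1 - localNorm f x (y - x))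

/-- `f` with domain `D` is a self-concordant barrier functional: it is self-concordant and
`ϑ_f = sup_{x ∈ D} ‖H(x)⁻¹ g(x)‖_x ^ 2` is finite, where `g` is the gradient of `f`. The
operator `H(x)` is invertible for `x ∈ D`, being positive definite in finite dimension. -/
structure IsSelfConcordantBarrier [FiniteDimensional ℝ E] (f : E → ℝ) (D : Set E) : Prop
    extends IsSelfConcordant f D where
  complexity_finite :
    BddAbove ((fun x => localNorm f x ((hessian f x).inverse (gradient f x)) ^ 2) '' D)

end SelfConcordance

/-- The `k`-element subsets `J` of `[n]`. -/
abbrev KSubset (n k : ℕ) : Type :=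
  {J : Finset (Fin n) // J.card = k}

/-- The space of families `(Y_J)` of symmetric real `k × k` matrices, one for each `k`-element
subset `J` of `[n]`. The entry `(Y_J)_{a b}` is the coordinate `(J, a, b)`; the inner product is
the one inherited from Euclidean space, that is `∑_J ∑_{a, b} (X_J)_{a b} (Y_J)_{a b}`, which is
`∑_J tr (X_J Y_J)`. -/
def symFamilies (n k : ℕ) : Submodule ℝ (EuclideanSpace ℝ (KSubset n k × Fin k × Fin k)) where
  carrier := {y | ∀ J a b, y (J, a, b) = y (J, b, a)}
  add_mem' := by
    intro x y hx hy J a b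
    simp [hx J a b, hy J a b]
  zero_mem' := by
    intro J a b
    simp
  smul_mem' := by
    intro c x hx J a b
    simp [hx J a b]

variable {n k : ℕ}

/-- The matrix `Y_J` of the family `Y`. -/
def block (Y : symFamilies n k) (J : KSubset n k) : Matrix (Fin k) (Fin k) ℝ :=
  Matrix.of fun a b => Y.1 (J, a, b)

/-- The product of positive semidefinite cones: all `Y_J` are positive semidefinite. -/
def psdFamilies (n k : ℕ) : Set (symFamilies n k) :=
  {Y | ∀ J, (block Y J).PosSemidef}

/-- For `J = {i_1 < ⋯ < i_k}` and a `k × k` matrix `S`, the `n × n` matrix whose `(i_a, i_b)`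
entry is `S_{a b}` and whose entries outside `J × J` are zero. -/
def extendByZero (J : KSubset n k) (S : Matrix (Fin k) (Fin k) ℝ) : Matrix (Fin n) (Fin n) ℝ :=
  Matrix.of fun i j =>
    if h : i ∈ J.1 ∧ j ∈ J.1 then
      S ((J.1.orderIsoOfFin J.2).symm ⟨i, h.1⟩) ((J.1.orderIsoOfFin J.2).symm ⟨j, h.2⟩)
    else 0

/-- The operator `Ψ(Y) = ∑_J Y_J^{→ n}`. -/
def Psi (Y : symFamilies n k) : Matrix (Fin n) (Fin n) ℝ :=
  ∑ J : KSubset n k, extendByZero J (block Y J)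

/-- `f(Y) = -∑_J log det Y_J`. -/
def fFW (Y : symFamilies n k) : ℝ :=
  -∑ J : KSubset n k, Real.log (block Y J).det

/-- `f(X) = -log det X`. -/
def fSDP (X : Matrix (Fin n) (Fin n) ℝ) : ℝ :=
  -Real.log X.det

end FactorWidth

end

/-!
For `f = -∑ log det` of matrices depending linearly on a point, the Hessian at `Y` is
`⟨U, V⟩_Y = tr (Y⁻¹ U Y⁻¹ V)` on each summand. Cauchy–Schwarz against `Y x xᵀ Y` shows that
`‖Z - Y‖_Y ≤ t` implies `|xᵀ (Z - Y) x| ≤ t xᵀ Y x`, so that `(1 - t) Y ≤ Z` and `(1 - t) Z ≤ Y` in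
the Loewner order; since the form is antitone in `Y`, this gives the ratio bounds of local norms.
Homogeneity gives `H(x) x = -g(x)`, whence `ϑ_f` is the sum of the sizes of the matrices.

For the lower bound put `C = (n - 1).choose (k - 1)` and `M = C • X⁻¹`, and let `M_J` be the
principal submatrices of `M`. The inequality `log det A + log det B ≤ tr (A B) - k` for `A = M_J`,
`B = Y_J`, summed over `J`, gives `∑ log det Y_J ≤ tr (M X) - C n - ∑ log det M_J`, where
`tr (M X) = C n`, and Szász's inequality bounds `∑ log det M_J` below by `C log det M`. Szász's
inequality holds because each principal minor of `B Bᵀ`, with `B` a Cholesky factor, is at least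
the product of the corresponding squared diagonal entries of `B`.
-/

namespace FactorWidth
open Matrix
open scoped MatrixOrder ComplexOrder Topology

section Loewner

variable {ι 𝕜 : Type*} [Fintype ι] [RCLike 𝕜]

theorem trace_mul_nonneg {A B : Matrix ι ι 𝕜} (hA : A.PosSemidef) (hB : B.PosSemidef) :
    0 ≤ (A * B).trace := by
  classical
  obtain ⟨R, rfl⟩ := CStarAlgebra.nonneg_iff_eq_star_mul_self.1 hA.nonneg
  rw [Matrix.mul_assoc, trace_mul_comm]
  exact (hB.mul_mul_conjTranspose_same R).trace_nonneg

variable [DecidableEq ι]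

theorem inv_le_inv_of_posDef {A B : Matrix ι ι 𝕜} (hA : A.PosDef) (hAB : A ≤ B) : B⁻¹ ≤ A⁻¹ := by
  have hB : B.PosDef := by simpa using hA.add_posSemidef (le_iff.1 hAB)
  have := hB.isUnit.invertible
  have := hA.inv.isUnit.invertible
  have hA_inv : A⁻¹⁻¹ = A := nonsing_inv_nonsing_inv A ((isUnit_iff_isUnit_det A).1 hA.isUnit)
  have hblock : (fromBlocks B 1 1ᴴ A⁻¹).PosSemidef :=
    (hA.inv.fromBlocks₂₂ B 1).2 (by simpa [hA_inv] using le_iff.1 hAB)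
  exact le_iff.2 (by simpa using (hB.fromBlocks₁₁ 1 A⁻¹).1 hblock)

theorem log_det_le_trace_sub_card {C : Matrix ι ι ℝ} (hC : C.PosDef) :
    Real.log C.det ≤ C.trace - Fintype.card ι := by
  have hpos := hC.eigenvalues_pos
  calc Real.log C.det = ∑ i, Real.log (hC.1.eigenvalues i) := by
        rw [hC.1.det_eq_prod_eigenvalues]
        exact Real.log_prod fun i _ => (hpos i).ne'
    _ ≤ ∑ i, (hC.1.eigenvalues i - 1) :=
        Finset.sum_le_sum fun i _ => Real.log_le_sub_one_of_pos (hpos i)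
    _ = C.trace - Fintype.card ι := by
        rw [hC.1.trace_eq_sum_eigenvalues]
        simp

theorem log_det_add_log_det_le_trace_mul_sub_card {A B : Matrix ι ι ℝ} (hA : A.PosDef)
    (hB : B.PosDef) : Real.log A.det + Real.log B.det ≤ (A * B).trace - Fintype.card ι := by
  obtain ⟨R, hR, rfl⟩ := CStarAlgebra.isStrictlyPositive_iff_eq_star_mul_self.1
    hA.isStrictlyPositive
  have hC : (R * B * Rᴴ).PosDef :=
    hB.mul_mul_conjTranspose_same (vecMul_injective_iff_isUnit.2 hR)
  have htrace : (R * B * Rᴴ).trace = (star R * R * B).trace := by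
    rw [star_eq_conjTranspose, Matrix.mul_assoc Rᴴ, trace_mul_comm]
  have hdet : (R * B * Rᴴ).det = (star R * R).det * B.det := by
    simp only [star_eq_conjTranspose, det_mul]
    ring
  rw [← Real.log_mul hA.det_pos.ne' hB.det_pos.ne', ← hdet, ← htrace]
  exact log_det_le_trace_sub_card hC

theorem log_det_le_add_trace_inv_mul_sub_card {A B : Matrix ι ι ℝ} (hA : A.PosDef)
    (hB : B.PosDef) :
    Real.log B.det ≤ Real.log A.det + (A⁻¹ * B).trace - Fintype.card ι := by
  have := log_det_add_log_det_le_trace_mul_sub_card hA.inv hB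
  rw [det_nonsing_inv, Ring.inverse_eq_inv', Real.log_inv] at this
  linarith

theorem det_le_det_of_posDef {A B : Matrix ι ι ℝ} (hA : A.PosDef) (hAB : A ≤ B) :
    A.det ≤ B.det := by
  have hB : B.PosDef := by simpa using hA.add_posSemidef (le_iff.1 hAB)
  have htrace : (B⁻¹ * A).trace ≤ Fintype.card ι := by
    have := trace_mul_nonneg hB.inv.posSemidef (le_iff.1 hAB)
    rw [Matrix.mul_sub, nonsing_inv_mul _ ((isUnit_iff_isUnit_det B).1 hB.isUnit), trace_sub,
      trace_one] at this
    linarith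
  rw [← Real.log_le_log_iff hA.det_pos hB.det_pos]
  linarith [log_det_le_add_trace_inv_mul_sub_card hB hA]

end Loewner

section LogDetInner

variable {ι : Type*} [Fintype ι] [DecidableEq ι] {Y Z V W : Matrix ι ι ℝ} {c t : ℝ}

/-- The local inner product of `-log det` at `Y`. The conjugate transpose makes it positive
definite on all square matrices; on symmetric ones it is the Hessian of `-log det`. -/
noncomputable def logDetInner (Y : Matrix ι ι ℝ) : LinearMap.BilinForm ℝ (Matrix ι ι ℝ) :=
  LinearMap.mk₂ ℝ (fun U V => (Y⁻¹ * Uᴴ * Y⁻¹ * V).trace)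
    (by simp [Matrix.mul_add, Matrix.add_mul]) (by simp) (by simp [Matrix.mul_add]) (by simp)

theorem logDetInner_apply (Y U V : Matrix ι ι ℝ) :
    logDetInner Y U V = (Y⁻¹ * Uᴴ * Y⁻¹ * V).trace := rfl

theorem logDetInner_self_eq_card (hY : Y.PosDef) : logDetInner Y Y Y = Fintype.card ι := by
  have hdet := (isUnit_iff_isUnit_det Y).1 hY.isUnit
  rw [logDetInner_apply, hY.1.eq, nonsing_inv_mul _ hdet, Matrix.one_mul,
    nonsing_inv_mul _ hdet, trace_one]

theorem isSymm_logDetInner (hY : Y.IsHermitian) : LinearMap.IsSymm (logDetInner Y) where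
  eq U V := by
    rw [RingHom.id_apply, logDetInner_apply, ← star_trivial (trace _), ← trace_conjTranspose]
    simp only [conjTranspose_mul, conjTranspose_conjTranspose, hY.inv.eq, ← Matrix.mul_assoc]
    rw [trace_mul_comm]
    simp only [logDetInner_apply, Matrix.mul_assoc]

theorem logDetInner_self_pos (hY : Y.PosDef) (hV : V ≠ 0) : 0 < logDetInner Y V V := by
  obtain ⟨R, hR, hYR⟩ := CStarAlgebra.isStrictlyPositive_iff_eq_star_mul_self.1
    hY.inv.isStrictlyPositive
  rw [star_eq_conjTranspose] at hYR
  have hform : logDetInner Y V V = ((R * V * Rᴴ)ᴴ * (R * V * Rᴴ)).trace := by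
    simp only [logDetInner_apply, hYR, conjTranspose_mul, conjTranspose_conjTranspose,
      Matrix.mul_assoc]
    rw [trace_mul_comm]
    simp only [Matrix.mul_assoc]
  have hne : R * V * Rᴴ ≠ 0 := by
    rwa [Ne, ← star_eq_conjTranspose, hR.star.mul_left_eq_zero, hR.mul_right_eq_zero]
  rw [hform]
  exact (posSemidef_conjTranspose_mul_self _).trace_nonneg.lt_of_ne'
    (trace_conjTranspose_mul_self_eq_zero_iff.not.2 hne)

theorem logDetInner_self_nonneg (hY : Y.PosDef) (V : Matrix ι ι ℝ) : 0 ≤ logDetInner Y V V := by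
  rcases eq_or_ne V 0 with rfl | hV
  · simp
  · exact (logDetInner_self_pos hY hV).le

theorem sq_mul_logDetInner_self_le (hY : Y.PosDef) (hc : 0 < c) (h : c • Y ≤ Z)
    (V : Matrix ι ι ℝ) : c ^ 2 * logDetInner Z V V ≤ logDetInner Y V V := by
  have hZ : Z.PosDef := by simpa using (hY.smul hc).add_posSemidef (le_iff.1 h)
  have hinv : (Y⁻¹ - c • Z⁻¹).PosSemidef := by
    have := invertibleOfNonzero hc.ne'
    have hle := (le_iff.1 (inv_le_inv_of_posDef (hY.smul hc) h)).smul hc.le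
    rwa [inv_smul Y c ((isUnit_iff_isUnit_det Y).1 hY.isUnit), smul_sub, smul_smul, mul_invOf_self,
      one_smul] at hle
  have hsplit : logDetInner Y V V - c ^ 2 * logDetInner Z V V =
      ((Y⁻¹ - c • Z⁻¹) * (Vᴴ * Y⁻¹ * V)).trace +
        c * ((Y⁻¹ - c • Z⁻¹) * (V * Z⁻¹ * Vᴴ)).trace := by
    have hcomm (P : Matrix ι ι ℝ) := trace_mul_comm (Z⁻¹ * Vᴴ) (P * V)
    simp only [Matrix.mul_assoc] at hcomm
    simp only [logDetInner_apply, Matrix.sub_mul, Matrix.smul_mul, trace_sub, trace_smul,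
      smul_eq_mul, Matrix.mul_assoc, hcomm]
    ring
  have h₁ := trace_mul_nonneg hinv (hY.inv.posSemidef.conjTranspose_mul_mul_same V)
  have h₂ := trace_mul_nonneg hinv (hZ.inv.posSemidef.mul_mul_conjTranspose_same V)
  nlinarith

theorem sq_dotProduct_mulVec_le (hY : Y.PosDef) (W : Matrix ι ι ℝ) (x : ι → ℝ) :
    (x ⬝ᵥ W *ᵥ x) ^ 2 ≤ logDetInner Y W W * (x ⬝ᵥ Y *ᵥ x) ^ 2 := by
  have hdet := (isUnit_iff_isUnit_det Y).1 hY.isUnit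
  have hdual (V : Matrix ι ι ℝ) :
      logDetInner Y (Y * vecMulVec x x * Y) V = x ⬝ᵥ V *ᵥ x := by
    rw [logDetInner_apply, conjTranspose_mul, conjTranspose_mul, conjTranspose_vecMulVec, hY.1.eq]
    simp only [star_trivial, Matrix.mul_assoc, mul_nonsing_inv_cancel_left _ _ hdet,
      nonsing_inv_mul_cancel_left _ _ hdet]
    rw [trace_mul_comm, mul_vecMulVec, trace_vecMulVec, dotProduct_comm]
  have hself : x ⬝ᵥ (Y * vecMulVec x x * Y) *ᵥ x = (x ⬝ᵥ Y *ᵥ x) ^ 2 := by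
    rw [← mulVec_mulVec, ← mulVec_mulVec, vecMulVec_mulVec]
    rw [op_smul_eq_smul, mulVec_smul, dotProduct_smul, smul_eq_mul, sq]
  -- Cauchy–Schwarz against `Y x xᵀ Y`, which represents `W ↦ xᵀ W x`
  have hcs := (logDetInner Y).apply_sq_le_of_symm (logDetInner_self_nonneg hY)
    (isSymm_logDetInner hY.1) (Y * vecMulVec x x * Y) W
  rw [hdual, hdual, hself] at hcs
  linarith

theorem neg_smul_le_of_logDetInner_le (hY : Y.PosDef) (hW : W.IsHermitian) (ht : 0 ≤ t)
    (h : logDetInner Y W W ≤ t ^ 2) : -(t • Y) ≤ W := by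
  refine le_iff.2 (.of_dotProduct_mulVec_nonneg
    (by simpa using hW.add (hY.posSemidef.smul ht).1) fun x => ?_)
  have hYx : 0 ≤ x ⬝ᵥ Y *ᵥ x := by simpa using hY.posSemidef.dotProduct_mulVec_nonneg x
  have hsq : (x ⬝ᵥ W *ᵥ x) ^ 2 ≤ (t * (x ⬝ᵥ Y *ᵥ x)) ^ 2 := by
    rw [mul_pow]
    exact (sq_dotProduct_mulVec_le hY W x).trans (by gcongr)
  have := (abs_le_of_sq_le_sq' hsq (by positivity)).1
  simp [add_mulVec, smul_mulVec]
  linarith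

theorem center_smul_le_of_logDetInner_le (hY : Y.PosDef) (hZ : Z.IsHermitian) (ht : 0 ≤ t)
    (h : logDetInner Y (Z - Y) (Z - Y) ≤ t ^ 2) : (1 - t) • Y ≤ Z := by
  have := le_iff.1 (neg_smul_le_of_logDetInner_le hY (hZ.sub hY.1) ht h)
  refine le_iff.2 ?_
  convert this using 1
  module

theorem smul_le_center_of_logDetInner_le (hY : Y.PosDef) (hZ : Z.IsHermitian) (ht : 0 ≤ t)
    (ht₁ : t ≤ 1) (h : logDetInner Y (Z - Y) (Z - Y) ≤ t ^ 2) : (1 - t) • Z ≤ Y := by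
  have hneg := neg_smul_le_of_logDetInner_le hY (hY.1.sub hZ) ht
    (by rwa [← neg_sub Z Y, map_neg, map_neg, LinearMap.neg_apply, neg_neg])
  -- `Y - (1 - t) Z = (1 - t) ((Y - Z) + t Y) + t ^ 2 Y`
  have := ((le_iff.1 hneg).smul (sub_nonneg.2 ht₁)).add (hY.posSemidef.smul (sq_nonneg t))
  refine le_iff.2 ?_
  convert this using 1
  module

end LogDetInner

section SelfConcordance

variable {E : Type*} [NormedAddCommGroup E] [InnerProductSpace ℝ E] [CompleteSpace E]
  {f : E → ℝ} {D : Set E} {x : E}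

theorem differentiableAt_gradient (hf : ContDiffAt ℝ 2 f x) :
    DifferentiableAt ℝ (gradient f) x :=
  (InnerProductSpace.toDual ℝ E).symm.differentiableAt.comp x
    ((hf.fderiv_right (m := 1) (by norm_num)).differentiableAt one_ne_zero)

variable [FiniteDimensional ℝ E]

theorem IsSelfConcordant.of_sq_mul_localInner_le (hopen : IsOpen D) (hconvex : Convex ℝ D)
    (hf : ContDiffOn ℝ 2 f D) (hpos : ∀ x ∈ D, ∀ v ≠ 0, 0 < localInner f x v v)
    (hball : ∀ x ∈ D, ∀ y ∈ localBall f x x 1, y ∈ D ∧ ∀ v,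
      (1 - localNorm f x (y - x)) ^ 2 * localInner f x v v ≤ localInner f y v v ∧
        (1 - localNorm f x (y - x)) ^ 2 * localInner f y v v ≤ localInner f x v v) :
    IsSelfConcordant f D where
  isOpen := hopen
  convex := hconvex
  contDiffOn := hf
  hessian_pos := hpos
  ball_subset x hx y hy := (hball x hx y hy).1
  norm_ratio x hx y hy v hv := by
    obtain ⟨hlower, hupper⟩ := (hball x hx y hy).2 v
    have ht : 0 < 1 - localNorm f x (y - x) := sub_pos.2 hy
    have hnorm : 0 < localNorm f x v := Real.sqrt_pos.2 (hpos x hx v hv)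
    have hsqrt {a b : ℝ} (hab : (1 - localNorm f x (y - x)) ^ 2 * a ≤ b) :
        (1 - localNorm f x (y - x)) * √a ≤ √b := by
      simpa only [Real.sqrt_mul (sq_nonneg _), Real.sqrt_sq ht.le] using Real.sqrt_le_sqrt hab
    refine ⟨(le_div_iff₀ hnorm).2 (hsqrt hlower), ?_⟩
    rw [div_le_div_iff₀ hnorm ht, one_mul, mul_comm]
    exact hsqrt hupper

theorem IsSelfConcordant.inverse_hessian_apply (hf : IsSelfConcordant f D) (hx : x ∈ D) (u : E) :
    (hessian f x).inverse (hessian f x u) = u := by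
  have hinj : Function.Injective (hessian f x : E →ₗ[ℝ] E) := by
    refine (injective_iff_map_eq_zero _).2 fun v hv => by_contra fun hv₀ => ?_
    have hv' : hessian f x v = 0 := hv
    have := hf.hessian_pos x hx v hv₀
    rw [localInner, hv', inner_zero_right] at this
    exact this.false
  let e := (LinearEquiv.ofInjectiveEndo _ hinj).toContinuousLinearEquiv
  have he : hessian f x = (e : E →L[ℝ] E) := rfl
  rw [he, ContinuousLinearMap.inverse_equiv]
  exact e.symm_apply_apply u

end SelfConcordance

section LogDetBarrier

variable {E σ ι : Type*} [NormedAddCommGroup E] [InnerProductSpace ℝ E]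
  {T : σ → E →ₗ[ℝ] Matrix ι ι ℝ} {x y : E} {t : ℝ}

/-- The points at which all the matrices `T s x` are positive definite: the domain of the barrier
`logDetBarrier T`. -/
def posDefPreimage (T : σ → E →ₗ[ℝ] Matrix ι ι ℝ) : Set E :=
  {x | ∀ s, (T s x).PosDef}

theorem convex_posDefPreimage (T : σ → E →ₗ[ℝ] Matrix ι ι ℝ) : Convex ℝ (posDefPreimage T) := by
  refine convex_iff_forall_pos.2 fun x hx y hy a b ha hb _ s => ?_
  rw [map_add, map_smul, map_smul]
  exact ((hx s).smul ha).add ((hy s).smul hb)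

variable [Fintype σ] [Fintype ι] [DecidableEq ι]

/-- The barrier `-∑ log det (T s x)` attached to linear maps into the symmetric matrices. -/
noncomputable def logDetBarrier (T : σ → E →ₗ[ℝ] Matrix ι ι ℝ) (x : E) : ℝ :=
  -∑ s, Real.log (T s x).det

/-- The pullback to `E` of the local inner products `logDetInner (T s x)`; it is the Hessian of
`logDetBarrier T` at `x`. -/
noncomputable def logDetBarrierInner (T : σ → E →ₗ[ℝ] Matrix ι ι ℝ) (x : E) :
    LinearMap.BilinForm ℝ E :=
  ∑ s, (logDetInner (T s x)).compl₁₂ (T s) (T s)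

theorem logDetBarrierInner_apply (T : σ → E →ₗ[ℝ] Matrix ι ι ℝ) (x u v : E) :
    logDetBarrierInner T x u v = ∑ s, logDetInner (T s x) (T s u) (T s v) := by
  simp [logDetBarrierInner]

theorem logDetBarrierInner_self_nonneg (hx : x ∈ posDefPreimage T) (v : E) :
    0 ≤ logDetBarrierInner T x v v := by
  rw [logDetBarrierInner_apply]
  exact Finset.sum_nonneg fun s _ => logDetInner_self_nonneg (hx s) _

theorem logDetBarrierInner_self_pos (hT : ∀ v, (∀ s, T s v = 0) → v = 0)
    (hx : x ∈ posDefPreimage T) {v : E} (hv : v ≠ 0) : 0 < logDetBarrierInner T x v v := by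
  obtain ⟨s, hs⟩ : ∃ s, T s v ≠ 0 := by
    contrapose! hv
    exact hT v hv
  rw [logDetBarrierInner_apply]
  exact Finset.sum_pos' (fun s _ => logDetInner_self_nonneg (hx s) _)
    ⟨s, Finset.mem_univ s, logDetInner_self_pos (hx s) hs⟩

theorem mem_posDefPreimage_and_logDetBarrierInner_bounds (hT : ∀ s v, (T s v).IsHermitian)
    (hx : x ∈ posDefPreimage T) (ht : 0 ≤ t) (ht₁ : t < 1)
    (h : logDetBarrierInner T x (y - x) (y - x) ≤ t ^ 2) :
    y ∈ posDefPreimage T ∧ ∀ v,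
      (1 - t) ^ 2 * logDetBarrierInner T x v v ≤ logDetBarrierInner T y v v ∧
        (1 - t) ^ 2 * logDetBarrierInner T y v v ≤ logDetBarrierInner T x v v := by
  have ht' : 0 < 1 - t := sub_pos.2 ht₁
  have hs (s : σ) : logDetInner (T s x) (T s y - T s x) (T s y - T s x) ≤ t ^ 2 := by
    rw [logDetBarrierInner_apply] at h
    rw [← map_sub]
    exact (Finset.single_le_sum (f := fun s => logDetInner (T s x) (T s (y - x)) (T s (y - x)))
      (fun s _ => logDetInner_self_nonneg (hx s) _) (Finset.mem_univ s)).trans h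
  have hlower (s : σ) := center_smul_le_of_logDetInner_le (hx s) (hT s y) ht (hs s)
  have hupper (s : σ) := smul_le_center_of_logDetInner_le (hx s) (hT s y) ht ht₁.le (hs s)
  have hy (s : σ) : (T s y).PosDef := by
    simpa using ((hx s).smul ht').add_posSemidef (le_iff.1 (hlower s))
  refine ⟨hy, fun v => ?_⟩
  simp only [logDetBarrierInner_apply, Finset.mul_sum]
  exact ⟨Finset.sum_le_sum fun s _ => sq_mul_logDetInner_self_le (hy s) ht' (hupper s) _,
    Finset.sum_le_sum fun s _ => sq_mul_logDetInner_self_le (hx s) ht' (hlower s) _⟩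

end LogDetBarrier

section Interior

variable {E σ ι : Type*} [NormedAddCommGroup E] [InnerProductSpace ℝ E] [FiniteDimensional ℝ E]
  [Finite σ] [Finite ι] {T : σ → E →ₗ[ℝ] Matrix ι ι ℝ}

theorem isOpen_posDefPreimage (hT : ∀ s v, (T s v).IsHermitian) : IsOpen (posDefPreimage T) := by
  classical
  cases nonempty_fintype σ
  cases nonempty_fintype ι
  refine isOpen_iff_mem_nhds.2 fun x hx => ?_
  have hcont : Continuous fun y => logDetBarrierInner T x (y - x) (y - x) := by
    have := (logDetBarrierInner T x).toContinuousBilinearMap.continuous₂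
    exact this.comp ((continuous_sub_right x).prodMk (continuous_sub_right x))
  have hlt : logDetBarrierInner T x (x - x) (x - x) < (1 / 2) ^ 2 := by simp
  filter_upwards [hcont.continuousAt.eventually_lt continuousAt_const hlt] with y hy
  exact (mem_posDefPreimage_and_logDetBarrierInner_bounds hT hx (by norm_num) (by norm_num)
    hy.le).1

theorem interior_setOf_posSemidef (hT : ∀ s v, (T s v).IsHermitian) {e : E}
    (he : e ∈ posDefPreimage T) :
    interior {x | ∀ s, (T s x).PosSemidef} = posDefPreimage T := by
  refine Set.Subset.antisymm (fun x hx => ?_) (interior_maximal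
    (fun x hx s => (hx s).posSemidef) (isOpen_posDefPreimage hT))
  have hline : Filter.Tendsto (fun r : ℝ => x - r • e) (𝓝[>] 0) (𝓝 x) := by
    have : Continuous fun r : ℝ => x - r • e := by fun_prop
    simpa using this.continuousAt.continuousWithinAt.tendsto (x := (0 : ℝ)) (s := Set.Ioi 0)
  obtain ⟨r, hr, hr₀⟩ :=
    ((hline.eventually (mem_interior_iff_mem_nhds.1 hx)).and self_mem_nhdsWithin).exists
  intro s
  simpa using PosDef.posSemidef_add (hr s) ((he s).smul hr₀)

end Interior

section Derivatives

variable {ι : Type*} [Fintype ι] [DecidableEq ι]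

open scoped Matrix.Norms.Operator in
theorem hasLineDerivAt_trace_inv_mul {Y : Matrix ι ι ℝ} (hY : IsUnit Y) (U V : Matrix ι ι ℝ) :
    HasLineDerivAt ℝ (fun Z : Matrix ι ι ℝ => (Z⁻¹ * U).trace)
      (-(Y⁻¹ * V * Y⁻¹ * U).trace) Y V := by
  have hinv := hasFDerivAt_ringInverse (𝕜 := ℝ) hY.unit
  rw [coe_units_inv, IsUnit.unit_spec] at hinv
  let tr : Matrix ι ι ℝ →L[ℝ] ℝ :=
    ((traceLinearMap ι ℝ ℝ).comp (LinearMap.mulRight ℝ U)).toContinuousLinearMap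
  have := (tr.hasFDerivAt.comp Y hinv).hasLineDerivAt V
  simp only [Function.comp_def, ← nonsing_inv_eq_ringInverse] at this
  exact this.congr_deriv (map_neg tr (Y⁻¹ * V * Y⁻¹))

variable {E σ : Type*} [NormedAddCommGroup E] [InnerProductSpace ℝ E] [FiniteDimensional ℝ E]
  [Fintype σ] {T : σ → E →ₗ[ℝ] Matrix ι ι ℝ} {x : E}

theorem contDiffOn_logDetBarrier (T : σ → E →ₗ[ℝ] Matrix ι ι ℝ) :
    ContDiffOn ℝ 2 (logDetBarrier T) (posDefPreimage T) := by
  intro x hx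
  refine (ContDiffAt.neg (ContDiffAt.sum fun s _ =>
    ContDiffAt.log ?_ (hx s).det_pos.ne')).contDiffWithinAt
  have hentry (i j : ι) : ContDiff ℝ 2 fun x => T s x i j :=
    ((entryLinearMap ℝ ℝ i j).comp (T s)).toContinuousLinearMap.contDiff
  simp only [det_apply]
  exact ContDiffAt.sum fun τ _ =>
    ((contDiff_prod fun i _ => hentry (τ i) i).contDiffAt).const_smul _

variable [CompleteSpace E]

theorem inner_gradient_logDetBarrier (hT : ∀ s v, (T s v).IsHermitian)
    (hx : x ∈ posDefPreimage T) (v : E) :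
    inner ℝ v (gradient (logDetBarrier T) x) = -∑ s, ((T s x)⁻¹ * T s v).trace := by
  have hnhds := (isOpen_posDefPreimage hT).mem_nhds hx
  have hgrad := (((contDiffOn_logDetBarrier T).contDiffAt hnhds).differentiableAt
    two_ne_zero).hasGradientAt.hasFDerivAt.hasLineDerivAt v
  have hderiv := HasDerivAt.add hgrad
    ((hasDerivAt_id (0 : ℝ)).mul_const (∑ s, ((T s x)⁻¹ * T s v).trace))
  -- The tangent inequality already yields the gradient: `f` minus its tangent is minimal at `x`.
  have hmin : IsLocalMin (fun r : ℝ => logDetBarrier T (x + r • v) +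
      r * ∑ s, ((T s x)⁻¹ * T s v).trace) 0 := by
    have hmem : ∀ᶠ r : ℝ in 𝓝 0, x + r • v ∈ posDefPreimage T :=
      (by fun_prop : Continuous fun r : ℝ => x + r • v).continuousAt.eventually_mem
        (by simpa using hnhds)
    filter_upwards [hmem] with r hr
    have htangent := Finset.sum_le_sum fun s (_ : s ∈ Finset.univ) =>
      log_det_le_add_trace_inv_mul_sub_card (hx s) (hr s)
    have hone (s : σ) : (T s x)⁻¹ * T s x = 1 :=
      nonsing_inv_mul _ ((isUnit_iff_isUnit_det _).1 (hx s).isUnit)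
    simp only [map_add, map_smul, Matrix.mul_add, Matrix.mul_smul, hone, trace_add, trace_smul,
      trace_one, smul_eq_mul, logDetBarrier, zero_smul, add_zero, zero_mul,
      Finset.sum_add_distrib, Finset.sum_sub_distrib, ← Finset.mul_sum] at htangent ⊢
    linarith
  have := hmin.hasDerivAt_eq_zero hderiv
  rw [InnerProductSpace.toDual_apply_apply, real_inner_comm] at this
  linarith

theorem localInner_logDetBarrier (hT : ∀ s v, (T s v).IsHermitian)
    (hx : x ∈ posDefPreimage T) (u v : E) :
    localInner (logDetBarrier T) x u v = logDetBarrierInner T x u v := by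
  have hnhds := (isOpen_posDefPreimage hT).mem_nhds hx
  have hgrad := (differentiableAt_gradient
    ((contDiffOn_logDetBarrier T).contDiffAt hnhds)).hasFDerivAt
  have hleft : HasLineDerivAt ℝ (fun y => inner ℝ u (gradient (logDetBarrier T) y))
      (localInner (logDetBarrier T) x u v) x v :=
    ((innerSL ℝ u).hasFDerivAt.comp x hgrad).hasLineDerivAt v
  have hright : HasLineDerivAt ℝ (fun y => -∑ s, ((T s y)⁻¹ * T s u).trace)
      (logDetBarrierInner T x u v) x v := by
    have := (HasDerivAt.fun_sum fun s (_ : s ∈ Finset.univ) =>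
      hasLineDerivAt_trace_inv_mul (hx s).isUnit (T s u) (T s v)).neg
    simp only [HasLineDerivAt, map_add, map_smul]
    refine this.congr_deriv ?_
    rw [logDetBarrierInner_apply, ← Finset.sum_neg_distrib]
    refine Finset.sum_congr rfl fun s _ => ?_
    rw [neg_neg, logDetInner_apply, (hT s u).eq, Matrix.mul_assoc _ (T s x)⁻¹ (T s u),
      trace_mul_comm, ← Matrix.mul_assoc]
  have heq : (fun y => inner ℝ u (gradient (logDetBarrier T) y)) =ᶠ[𝓝 x]
      fun y => -∑ s, ((T s y)⁻¹ * T s u).trace := by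
    filter_upwards [hnhds] with y hy using inner_gradient_logDetBarrier hT hy u
  exact hleft.lineDeriv.symm.trans (heq.lineDeriv_eq.trans hright.lineDeriv)

theorem hessian_logDetBarrier_neg_self (hT : ∀ s v, (T s v).IsHermitian)
    (hx : x ∈ posDefPreimage T) :
    hessian (logDetBarrier T) x (-x) = gradient (logDetBarrier T) x := by
  refine ext_inner_left ℝ fun u => ?_
  rw [inner_gradient_logDetBarrier hT hx, ← localInner, localInner_logDetBarrier hT hx, map_neg,
    logDetBarrierInner_apply]
  refine congrArg _ (Finset.sum_congr rfl fun s _ => ?_)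
  rw [logDetInner_apply, (hT s u).eq, nonsing_inv_mul_cancel_right _ _
    ((isUnit_iff_isUnit_det _).1 (hx s).isUnit)]

theorem isSelfConcordant_logDetBarrier (hT : ∀ s v, (T s v).IsHermitian)
    (hT₀ : ∀ v, (∀ s, T s v = 0) → v = 0) :
    IsSelfConcordant (logDetBarrier T) (posDefPreimage T) := by
  have hinner {x : E} (hx : x ∈ posDefPreimage T) := localInner_logDetBarrier hT hx
  have hpos (x) (hx : x ∈ posDefPreimage T) (v : E) (hv : v ≠ 0) :
      0 < localInner (logDetBarrier T) x v v := by
    rw [hinner hx]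
    exact logDetBarrierInner_self_pos hT₀ hx hv
  refine .of_sq_mul_localInner_le (isOpen_posDefPreimage hT) (convex_posDefPreimage T)
    (contDiffOn_logDetBarrier T) hpos fun x hx y hy => ?_
  have hsq : localNorm (logDetBarrier T) x (y - x) ^ 2 =
      logDetBarrierInner T x (y - x) (y - x) := by
    rw [localNorm, hinner hx, Real.sq_sqrt (logDetBarrierInner_self_nonneg hx _)]
  obtain ⟨hy', hbounds⟩ := mem_posDefPreimage_and_logDetBarrierInner_bounds hT hx
    (Real.sqrt_nonneg _) hy hsq.ge
  refine ⟨hy', fun v => ?_⟩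
  rw [hinner hx, hinner hy']
  exact hbounds v

theorem isSelfConcordantBarrier_logDetBarrier (hT : ∀ s v, (T s v).IsHermitian)
    (hT₀ : ∀ v, (∀ s, T s v = 0) → v = 0) :
    IsSelfConcordantBarrier (logDetBarrier T) (posDefPreimage T) where
  toIsSelfConcordant := isSelfConcordant_logDetBarrier hT hT₀
  complexity_finite := by
    refine ⟨∑ _s : σ, (Fintype.card ι : ℝ), ?_⟩
    rintro _ ⟨x, hx, rfl⟩
    have hnewton : (hessian (logDetBarrier T) x).inverse (gradient (logDetBarrier T) x) = -x := by
      rw [← hessian_logDetBarrier_neg_self hT hx,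
        (isSelfConcordant_logDetBarrier hT hT₀).inverse_hessian_apply hx]
    have hself : localInner (logDetBarrier T) x (-x) (-x) = ∑ _s : σ, (Fintype.card ι : ℝ) := by
      rw [localInner_logDetBarrier hT hx, logDetBarrierInner_apply]
      refine Finset.sum_congr rfl fun s _ => ?_
      simp [logDetInner_self_eq_card (hx s)]
    dsimp only
    rw [hnewton, localNorm, hself, Real.sq_sqrt (by positivity)]

end Derivatives

section Families

variable {n k : ℕ}

/-- The linear map `Y ↦ Y_J`. -/
def blockLinearMap (J : KSubset n k) : symFamilies n k →ₗ[ℝ] Matrix (Fin k) (Fin k) ℝ where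
  toFun Y := block Y J
  map_add' _ _ := rfl
  map_smul' _ _ := rfl

theorem isHermitian_block (J : KSubset n k) (Y : symFamilies n k) : (block Y J).IsHermitian := by
  ext a b
  exact Y.2 J b a

theorem eq_zero_of_block_eq_zero (Y : symFamilies n k) (h : ∀ J, block Y J = 0) : Y = 0 := by
  ext ⟨J, a, b⟩
  exact congrFun₂ (h J) a b

theorem exists_block_eq_one (n k : ℕ) : ∃ Y : symFamilies n k, ∀ J, block Y J = 1 :=
  ⟨⟨WithLp.toLp 2 fun p => (1 : Matrix (Fin k) (Fin k) ℝ) p.2.1 p.2.2,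
    fun _ a b => congrFun₂ (transpose_one (α := ℝ)).symm a b⟩, fun _ => rfl⟩

theorem interior_psdFamilies :
    interior (psdFamilies n k) = {Y | ∀ J, (block Y J).PosDef} := by
  obtain ⟨Y, hY⟩ := exists_block_eq_one n k
  have hmem : Y ∈ posDefPreimage blockLinearMap := fun J => by
    rw [show blockLinearMap J Y = 1 from hY J]
    exact .one
  exact interior_setOf_posSemidef isHermitian_block hmem

theorem isSelfConcordantBarrier_fFW :
    IsSelfConcordantBarrier (fFW : symFamilies n k → ℝ) (interior (psdFamilies n k)) := by
  rw [interior_psdFamilies]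
  exact isSelfConcordantBarrier_logDetBarrier (T := blockLinearMap) isHermitian_block
    eq_zero_of_block_eq_zero

end Families

section Szasz

variable {ι κ σ : Type*} [Fintype ι]

theorem submatrix_mul_transpose_le [Finite κ] [Fintype σ] (R : Matrix κ ι ℝ) (f : σ ↪ ι) :
    R.submatrix id f * (R.submatrix id f)ᵀ ≤ R * Rᵀ := by
  classical
  let C := R.submatrix id (Subtype.val : ↥(Finset.univ.map f)ᶜ → ι)
  have hsplit : R * Rᵀ - R.submatrix id f * (R.submatrix id f)ᵀ = C * Cᵀ := by
    ext a b
    rw [Matrix.sub_apply, sub_eq_iff_eq_add']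
    simp only [mul_apply, transpose_apply, submatrix_apply, id_eq, C]
    rw [Finset.sum_coe_sort (Finset.univ.map f)ᶜ fun i => R a i * R b i,
      ← Finset.sum_add_sum_compl (Finset.univ.map f), Finset.sum_map]
  rw [le_iff, hsplit]
  exact posSemidef_self_mul_conjTranspose C

theorem sum_sum_embedding_eq_mul_sum {R : Type*} [NonAssocSemiring R] [Fintype κ] [Fintype σ]
    {c : ℕ} (e : σ → κ ↪ ι) (hc : ∀ i, {s | i ∈ Set.range (e s)}.ncard = c) (g : ι → R) :
    ∑ s, ∑ a, g (e s a) = c * ∑ i, g i := by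
  classical
  calc ∑ s, ∑ a, g (e s a) = ∑ s, ∑ i ∈ Finset.univ.map (e s), g i := by
        simp only [Finset.sum_map]
    _ = ∑ i, ∑ s with i ∈ Set.range (e s), g i := Finset.sum_comm' (by simp)
    _ = ∑ i, c * g i := by
        refine Finset.sum_congr rfl fun i _ => ?_
        rw [Finset.sum_const, nsmul_eq_mul, ← hc i, Set.ncard_eq_toFinset_card',
          Set.toFinset_ofPred]
    _ = c * ∑ i, g i := (Finset.mul_sum _ _ _).symm

variable [LinearOrder ι]

theorem exists_isLowerTriangular_mul_transpose {M : Matrix ι ι ℝ} (hM : M.PosDef) :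
    ∃ B : Matrix ι ι ℝ, B.IsLowerTriangular ∧ B * Bᵀ = M := by
  let _ : LocallyFiniteOrderBot ι := 
    .ofIic ι (fun i => {j | j ≤ i}) fun i j => by simp
  have hlower : (LDL.lower hM).IsLowerTriangular :=
    blockTriangular_inv_of_blockTriangular fun _ _ hij => LDL.lowerInv_triangular hM hij
  have hdiag : (LDL.diag hM).PosDef := by
    rw [LDL.diag_eq_lowerInv_conj]
    exact hM.mul_mul_conjTranspose_same
      (vecMul_injective_iff_isUnit.2 (isUnit_of_invertible (LDL.lowerInv hM)))
  have hsq (i : ι) : √(LDL.diagEntries hM i) * √(LDL.diagEntries hM i) = LDL.diagEntries hM i :=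
    Real.mul_self_sqrt (posDef_diagonal_iff.1 hdiag i).le
  refine ⟨LDL.lower hM * diagonal fun i => √(LDL.diagEntries hM i),
    hlower.mul (blockTriangular_diagonal _), ?_⟩
  conv_rhs => rw [← LDL.lower_conj_diag hM, LDL.diag]
  simp only [transpose_mul, diagonal_transpose, Matrix.mul_assoc,
    conjTranspose_eq_transpose_of_trivial]
  rw [← Matrix.mul_assoc (diagonal _) (diagonal _), diagonal_mul_diagonal]
  simp only [hsq]

variable [Fintype κ] [LinearOrder κ]

theorem prod_sq_diag_le_det_submatrix {B : Matrix ι ι ℝ} (hB : B.IsLowerTriangular)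
    (hB₀ : ∀ i, B i i ≠ 0) (e : κ ↪o ι) :
    ∏ a, B (e a) (e a) ^ 2 ≤ ((B * Bᵀ).submatrix e e).det := by
  have hN : (B.submatrix e e).IsLowerTriangular := fun _ _ hab => hB (e.lt_iff_lt.2 hab)
  have hdet : (B.submatrix e e).det = ∏ a, B (e a) (e a) := det_of_isLowerTriangular _ hN
  have hunit : IsUnit (B.submatrix e e) := by
    rw [isUnit_iff_isUnit_det, hdet, isUnit_iff_ne_zero]
    exact Finset.prod_ne_zero_iff.2 fun a _ => hB₀ (e a)
  calc ∏ a, B (e a) (e a) ^ 2 = (B.submatrix e e * (B.submatrix e e)ᵀ).det := by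
        rw [det_mul, det_transpose, hdet, Finset.prod_pow, sq]
    _ ≤ (B.submatrix e id * (B.submatrix e id)ᵀ).det :=
        det_le_det_of_posDef (.mul_conjTranspose_self _ (vecMul_injective_iff_isUnit.2 hunit))
          (submatrix_mul_transpose_le (B.submatrix e id) e.toEmbedding)
    _ = ((B * Bᵀ).submatrix e e).det := rfl

/-- Szász's determinant inequality, for arbitrary uniform coverings of the index set. -/
theorem mul_log_det_le_sum_log_det_submatrix [Fintype σ] {M : Matrix ι ι ℝ} (hM : M.PosDef)
    (e : σ → κ ↪o ι) {c : ℕ} (hc : ∀ i, {s | i ∈ Set.range (e s)}.ncard = c) :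
    c * Real.log M.det ≤ ∑ s, Real.log (M.submatrix (e s) (e s)).det := by
  obtain ⟨B, hB, rfl⟩ := exists_isLowerTriangular_mul_transpose hM
  have hdet : (B * Bᵀ).det = ∏ i, B i i ^ 2 := by
    rw [det_mul, det_transpose, det_of_isLowerTriangular B hB, Finset.prod_pow, sq]
  have hB₀ (i : ι) : B i i ^ 2 ≠ 0 :=
    Finset.prod_ne_zero_iff.1 (hdet ▸ hM.det_pos.ne') i (Finset.mem_univ i)
  calc c * Real.log (B * Bᵀ).det = c * ∑ i, Real.log (B i i ^ 2) := by
        rw [hdet, Real.log_prod fun i _ => hB₀ i]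
    _ = ∑ s, ∑ a, Real.log (B (e s a) (e s a) ^ 2) :=
        (sum_sum_embedding_eq_mul_sum (fun s => (e s).toEmbedding) hc _).symm
    _ ≤ ∑ s, Real.log ((B * Bᵀ).submatrix (e s) (e s)).det := ?_
  refine Finset.sum_le_sum fun s _ => ?_
  rw [← Real.log_prod fun a _ => hB₀ (e s a)]
  exact Real.log_le_log (Finset.prod_pos fun a _ => (sq_nonneg _).lt_of_ne' (hB₀ (e s a)))
    (prod_sq_diag_le_det_submatrix hB (fun i => pow_ne_zero_iff two_ne_zero |>.1 (hB₀ i)) (e s))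

end Szasz

section LowerBound

variable {n k : ℕ}

theorem extendByZero_eq_mul_mul_transpose (J : KSubset n k) (S : Matrix (Fin k) (Fin k) ℝ) :
    extendByZero J S = (1 : Matrix _ _ ℝ).submatrix id (J.1.orderEmbOfFin J.2) * S *
      ((1 : Matrix _ _ ℝ).submatrix id (J.1.orderEmbOfFin J.2))ᵀ := by
  ext i j
  have hmem {i : Fin n} (a : Fin k) (hi : i ∉ J.1) : i ≠ J.1.orderEmbOfFin J.2 a := by
    rintro rfl
    exact hi (J.1.orderEmbOfFin_mem J.2 a)
  have horder (i : Fin n) (hi : i ∈ J.1) (a : Fin k) :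
      i = J.1.orderEmbOfFin J.2 a ↔ (J.1.orderIsoOfFin J.2).symm ⟨i, hi⟩ = a := by
    rw [OrderIso.symm_apply_eq, Subtype.ext_iff]
    rfl
  simp only [extendByZero, of_apply, mul_apply, transpose_apply, submatrix_apply, id_eq, one_apply,
    ite_mul, mul_ite, one_mul, zero_mul, mul_one, mul_zero]
  by_cases hi : i ∈ J.1 <;> by_cases hj : j ∈ J.1 <;> simp [*]

theorem posSemidef_extendByZero {S : Matrix (Fin k) (Fin k) ℝ} (hS : S.PosSemidef)
    (J : KSubset n k) : (extendByZero J S).PosSemidef := by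
  rw [extendByZero_eq_mul_mul_transpose]
  exact hS.mul_mul_conjTranspose_same _

theorem trace_mul_extendByZero (J : KSubset n k) (M : Matrix (Fin n) (Fin n) ℝ)
    (S : Matrix (Fin k) (Fin k) ℝ) :
    (M * extendByZero J S).trace =
      (M.submatrix (J.1.orderEmbOfFin J.2) (J.1.orderEmbOfFin J.2) * S).trace := by
  rw [extendByZero_eq_mul_mul_transpose, ← Matrix.mul_assoc, trace_mul_comm, ← Matrix.mul_assoc,
    ← Matrix.mul_assoc]
  congr 2
  ext a b
  simp [mul_apply, one_apply]

theorem dotProduct_extendByZero_mulVec (J : KSubset n k) (S : Matrix (Fin k) (Fin k) ℝ)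
    (x : Fin n → ℝ) :
    x ⬝ᵥ extendByZero J S *ᵥ x =
      (x ∘ J.1.orderEmbOfFin J.2) ⬝ᵥ S *ᵥ (x ∘ J.1.orderEmbOfFin J.2) := by
  have := trace_mul_extendByZero J (vecMulVec x x) S
  have hsub : (vecMulVec x x).submatrix (J.1.orderEmbOfFin J.2) (J.1.orderEmbOfFin J.2) =
      vecMulVec (x ∘ J.1.orderEmbOfFin J.2) (x ∘ J.1.orderEmbOfFin J.2) := rfl
  rwa [hsub, vecMulVec_mul, trace_vecMulVec, vecMulVec_mul, trace_vecMulVec, dotProduct_comm,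
    ← dotProduct_mulVec, dotProduct_comm _ (_ ᵥ* S), ← dotProduct_mulVec] at this

theorem posDef_Psi (hk : 0 < k) (hkn : k ≤ n) {Y : symFamilies n k}
    (hY : ∀ J, (block Y J).PosDef) : (Psi Y).PosDef := by
  refine .of_dotProduct_mulVec_pos
    (isSelfAdjoint_sum _ fun J _ => (posSemidef_extendByZero (hY J).posSemidef J).1) fun x hx => ?_
  obtain ⟨i, hi⟩ := Function.ne_iff.1 hx
  obtain ⟨J, hiJ, hJ⟩ := Finset.exists_superset_card_eq (s := {i}) (n := k)
    (by simpa using Nat.succ_le_of_lt hk) (by simpa using hkn)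
  have hne : x ∘ J.orderEmbOfFin hJ ≠ 0 := by
    obtain ⟨a, rfl⟩ : i ∈ Set.range (J.orderEmbOfFin hJ) := by simpa using hiJ
    exact fun h => hi (congrFun h a)
  rw [Psi, sum_mulVec, dotProduct_sum]
  refine Finset.sum_pos' (fun J _ =>
    (posSemidef_extendByZero (hY J).posSemidef J).dotProduct_mulVec_nonneg x)
    ⟨⟨J, hJ⟩, Finset.mem_univ _, ?_⟩
  rw [star_trivial, dotProduct_extendByZero_mulVec]
  simpa using (hY ⟨J, hJ⟩).dotProduct_mulVec_pos hne

theorem ncard_kSubset_mem (hk : 0 < k) (i : Fin n) :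
    {J : KSubset n k | i ∈ J.1}.ncard = (n - 1).choose (k - 1) := by
  have hmap : ({J | i ∈ J.1} : Finset (KSubset n k)).map (.subtype _) =
      {J ∈ (Finset.univ : Finset (Fin n)).powersetCard k | {i} ⊆ J} := by
    ext J
    simp [and_comm]
  rw [Set.ncard_eq_toFinset_card', Set.toFinset_ofPred, ← Finset.card_map, hmap,
    Finset.card_filter_powersetCard_subset _ _ _
    (Finset.subset_univ _) (by simpa using Nat.succ_le_of_lt hk)]
  simp

theorem sum_log_det_block_le (hk : 0 < k) {M : Matrix (Fin n) (Fin n) ℝ} (hM : M.PosDef)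
    {Y : symFamilies n k} (hY : ∀ J, (block Y J).PosDef) :
    ∑ J, Real.log (block Y J).det ≤
      (M * Psi Y).trace - (n - 1).choose (k - 1) * (n + Real.log M.det) := by
  let e (J : KSubset n k) : Fin k ↪o Fin n := J.1.orderEmbOfFin J.2
  have hcover (i : Fin n) : {J | i ∈ Set.range (e J)}.ncard = (n - 1).choose (k - 1) := by
    simpa only [e, Finset.range_orderEmbOfFin, Finset.mem_coe] using ncard_kSubset_mem hk i
  have hyoung (J : KSubset n k) : Real.log (M.submatrix (e J) (e J)).det +
      Real.log (block Y J).det ≤ (M * extendByZero J (block Y J)).trace - ∑ _a : Fin k, 1 := by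
    rw [trace_mul_extendByZero]
    simpa using log_det_add_log_det_le_trace_mul_sub_card (hM.submatrix (e J).injective) (hY J)
  have hszasz := mul_log_det_le_sum_log_det_submatrix hM e hcover
  have hcount := sum_sum_embedding_eq_mul_sum (fun J => (e J).toEmbedding) hcover fun _ => (1 : ℝ)
  have hsum := Finset.sum_le_sum fun J (_ : J ∈ Finset.univ) => hyoung J
  rw [Finset.sum_add_distrib, Finset.sum_sub_distrib, ← trace_sum, ← Finset.mul_sum, ← Psi,
    hcount, Fin.sum_const, nsmul_eq_mul, mul_one] at hsum
  linarith

theorem fFW_ge (hk : 0 < k) (hkn : k ≤ n) {Y : symFamilies n k}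
    (hY : ∀ J, (block Y J).PosDef) :
    fFW Y ≥ ((n - 1).choose (k - 1) : ℝ) * fSDP (Psi Y)
      + (n : ℝ) * ((n - 1).choose (k - 1) : ℝ) * Real.log ((n - 1).choose (k - 1) : ℝ) := by
  have hX := posDef_Psi hk hkn hY
  set C : ℝ := ((n - 1).choose (k - 1) : ℝ) with hC
  have hCpos : 0 < C := by
    rw [hC]
    exact_mod_cast Nat.choose_pos (by omega)
  have htrace : (C • (Psi Y)⁻¹ * Psi Y).trace = C * n := by
    rw [Matrix.smul_mul, nonsing_inv_mul _ ((isUnit_iff_isUnit_det _).1 hX.isUnit), trace_smul,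
      trace_one, Fintype.card_fin, smul_eq_mul]
  have hdet : Real.log (C • (Psi Y)⁻¹).det = n * Real.log C - Real.log (Psi Y).det := by
    rw [det_smul, det_nonsing_inv, Ring.inverse_eq_inv', Fintype.card_fin,
      Real.log_mul (pow_pos hCpos _).ne' (inv_pos.2 hX.det_pos).ne', Real.log_pow, Real.log_inv]
    ring
  have h := sum_log_det_block_le hk (hX.inv.smul hCpos) hY
  rw [htrace, hdet] at h
  rw [fFW, fSDP]
  linarith

end LowerBound

end FactorWidth

theorem lemma1_general (n k : ℕ) (hk : 0 < k) (hkn : k ≤ n) :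
    FactorWidth.IsSelfConcordantBarrier
        (FactorWidth.fFW : FactorWidth.symFamilies n k → ℝ)
        (interior (FactorWidth.psdFamilies n k)) ∧
      ∀ Y ∈ interior (FactorWidth.psdFamilies n k),
        ∀ X : Matrix (Fin n) (Fin n) ℝ, X = FactorWidth.Psi Y →
          FactorWidth.fFW Y ≥
            ((n - 1).choose (k - 1) : ℝ) * FactorWidth.fSDP X
              + (n : ℝ) * ((n - 1).choose (k - 1) : ℝ)
                * Real.log ((n - 1).choose (k - 1) : ℝ) := by
  refine ⟨FactorWidth.isSelfConcordantBarrier_fFW, ?_⟩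
  rintro Y hY _ rfl
  rw [FactorWidth.interior_psdFamilies] at hY
  exact FactorWidth.fFW_ge hk hkn hY

theorem lemma1 (n k : ℕ) (hn : 0 < n) (hk : 2 ≤ k) (hkn : k ∣ n) :
    FactorWidth.IsSelfConcordantBarrier
        (FactorWidth.fFW : FactorWidth.symFamilies n k → ℝ)
        (interior (FactorWidth.psdFamilies n k)) ∧
      ∀ Y ∈ interior (FactorWidth.psdFamilies n k),
        ∀ X : Matrix (Fin n) (Fin n) ℝ, X = FactorWidth.Psi Y →
          FactorWidth.fFW Y ≥
            ((n - 1).choose (k - 1) : ℝ) * FactorWidth.fSDP X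
              + (n : ℝ) * ((n - 1).choose (k - 1) : ℝ)
                * Real.log ((n - 1).choose (k - 1) : ℝ) := by
  exact lemma1_general n k (by omega) (Nat.le_of_dvd hn hkn)
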